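/- Let $\mathcal X$ be a compact metrizable space and $E$ a Polish space, and let $h:\mathcal X\times E\to\mathbb R$ be jointly continuous and bounded from below. Put $$\psi(w)=\Big(\sup_{x\in\mathcal X}h(x,w)\Big)^+ ,\qquad w\in E.$$ Let $q\in(1,\infty)$ and let $\mu$ be a Borel probability measure on $E$ with $\int_E\psi^q\,d\mu<\infty$. Let $\mathcal P_\psi(E)$ be the set of Borel probability measures $\nu$ on $E$ with $\int_E\psi\,d\nu<\infty$, equipped with the coarsest topology for which $\nu\mapsto\int_E f\,d\nu$ is continuous for every continuous $f:E\to\mathbb R$ with $|f|\le 1+\psi$, and with the corresponding Borel $\sigma$-algebra. For $n\ge1$ and $y=(y_1,\dots,y_n)\in E^n$ let $L_n(y)=\frac1n\sum_{i=1}^n\delta_{y_i}\in\mathcal P_\psi(E)$, and let $\mu^n$ denote the $n$-fold product measure on $E^n$. Let $\hat x:\mathcal P_\psi(E)\to\mathcal X$ be any measurable function with $$\hat x(\nu)\in\arg\min_{x\in\mathcal X}\int_E h(x,w)\,\nu(dw)\qquad\text{for each }\nu\in\mathcal P_\psi(E).$$ Suppose that $\varphi:\mathbb R\to\mathbb R$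 is measurable and $d$ is a metric on $\mathcal X$ inducing its topology such that, for all $x\in\mathcal X$, $$\varphi\big(d(\hat x(\mu),x)\big)\le\int_E h(x,w)\,\mu(dw)-\int_E h(\hat x(\mu),w)\,\mu(dw).$$ Then, for every $\epsilon>0$, $$\limsup_{n\to\infty}\,n^{q-1}\mu^n\Big(\varphi\big(d(\hat x(\mu),\hat x(L_n))\big)\ge\epsilon\Big)<\infty .$$ In particular, if $\varphi$ is strictly increasing with $\varphi(0)=0$, then for every $\epsilon>0$, $$\limsup_{n\to\infty}\,n^{q-1}\mu^n\Big(d(\hat x(\mu),\hat x(L_n))\ge\epsilon\Big)<\infty .$$ -/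

import Mathlib

open MeasureTheory Filter Set
open scoped ENNReal

namespace HeavyTailedOptimization

noncomputable section

/-- The envelope `ψ(w) = (sup_x h(x, w))⁺`. In the theorem `h` is continuous and the space of `x` is
nonempty and compact, so that the supremum is a maximum. -/
def envelope {X E : Type*} (h : X → E → ℝ) (w : E) : ℝ :=
  max (⨆ x, h x w) 0

/-- `𝒫_ψ(E)`: the probability measures `ν` on `E` with `∫ ψ dν < ∞`, for `ψ ≥ 0`. -/
def ProbWith {E : Type*} [MeasurableSpace E] (ψ : E → ℝ) : Type _ :=
  {ν : ProbabilityMeasure E // ∫⁻ w, ENNReal.ofReal (ψ w) ∂(ν : Measure E) < ∞}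

/-- The measure underlying an element of `𝒫_ψ(E)`. -/
def ProbWith.toMeasure {E : Type*} [MeasurableSpace E] {ψ : E → ℝ} (ν : ProbWith ψ) : Measure E :=
  (ν.1 : Measure E)

/-- The `ψ`-weak topology: the coarsest topology for which `ν ↦ ∫ f dν` is continuous for all
continuous `f` with `|f| ≤ 1 + ψ`. -/
instance ProbWith.instTopologicalSpace {E : Type*} [MeasurableSpace E] [TopologicalSpace E]
    (ψ : E → ℝ) : TopologicalSpace (ProbWith ψ) :=
  ⨅ f ∈ {f : E → ℝ | Continuous f ∧ ∀ w, |f w| ≤ 1 + ψ w},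
    TopologicalSpace.induced (fun ν : ProbWith ψ => ∫ w, f w ∂ν.toMeasure) inferInstance

/-- The Borel σ-algebra of the `ψ`-weak topology. -/
instance ProbWith.instMeasurableSpace {E : Type*} [MeasurableSpace E] [TopologicalSpace E]
    (ψ : E → ℝ) : MeasurableSpace (ProbWith ψ) :=
  borel (ProbWith ψ)

/-- A probability measure `μ` with `∫ ψ^q dμ < ∞`, where `q ≥ 1`, as an element of `𝒫_ψ(E)`. -/
def ProbWith.ofMoment {E : Type*} [MeasurableSpace E] {ψ : E → ℝ} {q : ℝ} (hq : 1 ≤ q)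
    (μ : ProbabilityMeasure E)
    (hμ : ∫⁻ w, ENNReal.ofReal (ψ w) ^ q ∂(μ : Measure E) < ∞) : ProbWith ψ :=
  ⟨μ, by
    have hle : ∀ w, ENNReal.ofReal (ψ w) ≤ 1 + ENNReal.ofReal (ψ w) ^ q := by
      intro w
      rcases le_total (ENNReal.ofReal (ψ w)) 1 with h1 | h1
      · exact h1.trans le_self_add
      · calc ENNReal.ofReal (ψ w) = ENNReal.ofReal (ψ w) ^ (1 : ℝ) := (ENNReal.rpow_one _).symm
          _ ≤ ENNReal.ofReal (ψ w) ^ q := ENNReal.rpow_le_rpow_of_exponent_le h1 hq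
          _ ≤ 1 + ENNReal.ofReal (ψ w) ^ q := le_add_self
    refine (lintegral_mono hle).trans_lt ?_
    rw [lintegral_add_left measurable_const]
    simpa using hμ⟩

/-- The measure `(1/n) ∑ i, δ_{y i}`. -/
def empiricalMeasure {E : Type*} [MeasurableSpace E] {n : ℕ} (y : Fin n → E) : Measure E :=
  (n : ℝ≥0∞)⁻¹ • ∑ i, Measure.dirac (y i)

/-- For `n ≥ 1`, the empirical measure `L_n(y) = (1/n) ∑ i, δ_{y i}` as an element of `𝒫_ψ(E)`. -/
def empirical {E : Type*} [MeasurableSpace E] [MeasurableSingletonClass E] (ψ : E → ℝ)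
    {n : ℕ} [NeZero n] (y : Fin n → E) : ProbWith ψ :=
  ⟨⟨empiricalMeasure y, ⟨by
      have hn : (n : ℝ≥0∞) ≠ 0 := by exact_mod_cast NeZero.ne n
      simp [empiricalMeasure, ENNReal.inv_mul_cancel hn (ENNReal.natCast_ne_top n)]⟩⟩, by
    have hn : (n : ℝ≥0∞) ≠ 0 := by exact_mod_cast NeZero.ne n
    simp only [ProbabilityMeasure.coe_mk, empiricalMeasure, lintegral_smul_measure,
      lintegral_finsetSum_measure, lintegral_dirac, smul_eq_mul]
    exact ENNReal.mul_lt_top (ENNReal.inv_lt_top.2 (pos_iff_ne_zero.2 hn))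
      (ENNReal.sum_lt_top.2 fun i _ => ENNReal.ofReal_lt_top)⟩

end

end HeavyTailedOptimization

namespace HeavyTailedOptimization

/-! By the growth condition, `φ(d) ≥ ε` forces the empirical minimizer to have true excess cost at
least `ε` over `x₀ = xhat(μ)`, although its empirical cost is at most that of `x₀`. So either the
empirical cost of `x₀` is too high, or that of some bad `x` is too low. Compactness makes the second
event finite: `X` is covered by finitely many balls on which the infimum of `h` has mean close to
the cost at the centre, and a low empirical cost anywhere in a ball forces a low empirical mean of
this infimum.

What remains is finitely many one-sided deviations of i.i.d. means of functions bounded by `c + ψ`,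
hence with a finite moment of order `q`. Each has probability `O(n^(1-q))`: some summand exceeds
`δn` with probability at most `n · O(n^(-q))`, and the sum truncated at `δn` obeys a Chernoff bound
of order `n^(-q)` with parameter of order `log n / n`. -/

/-! ### Deviations of i.i.d. sums with a finite moment of order `q` -/

theorem exp_le_one_add_add_abs_rpow_mul {p : ℝ} (hp1 : 1 ≤ p) (hp2 : p ≤ 2) (u : ℝ) :
    Real.exp u ≤ 1 + u + |u| ^ p * Real.exp (max u 0) := by
  rcases le_or_gt |u| 1 with h1 | h1
  · have h2 : Real.exp u - 1 - u ≤ u ^ 2 :=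
      (le_abs_self _).trans (Real.abs_exp_sub_one_sub_id_le h1)
    have h3 : u ^ 2 ≤ |u| ^ p := by
      rw [← sq_abs, ← Real.rpow_natCast]
      rcases (abs_nonneg u).eq_or_lt with h0 | h0
      · rw [← h0, Real.zero_rpow (by norm_num), Real.zero_rpow (by linarith)]
      · exact Real.rpow_le_rpow_of_exponent_ge h0 h1 (by exact_mod_cast hp2)
    have h4 : |u| ^ p ≤ |u| ^ p * Real.exp (max u 0) :=
      le_mul_of_one_le_right (by positivity) (Real.one_le_exp (le_max_right _ _))
    linarith
  · have h2 : |u| ≤ |u| ^ p := by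
      simpa using Real.rpow_le_rpow_of_exponent_le h1.le hp1
    rcases le_or_gt 0 u with hu | hu
    · rw [max_eq_left hu]
      have h3 : Real.exp u ≤ |u| ^ p * Real.exp u :=
        le_mul_of_one_le_left (Real.exp_pos u).le (by linarith)
      linarith
    · rw [max_eq_right hu.le, Real.exp_zero, mul_one]
      rw [abs_of_neg hu] at h1 h2 ⊢
      have : Real.exp u ≤ 1 := Real.exp_le_one_iff.2 hu.le
      linarith

theorem abs_min_le_abs {a T : ℝ} (hT : 0 ≤ T) : |min a T| ≤ |a| := by
  rcases le_total a T with h | h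
  · rw [min_eq_left h]
  · rw [min_eq_right h, abs_of_nonneg hT]; exact h.trans (le_abs_self a)

variable {E : Type*} [MeasurableSpace E]

theorem integrable_exp_mul_min {μ : Measure E} [IsProbabilityMeasure μ] {f : E → ℝ}
    (hf : Measurable f) {T l : ℝ} (hl : 0 ≤ l) :
    Integrable (fun w => Real.exp (l * min (f w) T)) μ := by
  refine Integrable.of_bound (C := Real.exp (l * T)) (by fun_prop) (ae_of_all _ fun w => ?_)
  rw [Real.norm_eq_abs, Real.abs_exp]
  exact Real.exp_le_exp.2 (mul_le_mul_of_nonneg_left (min_le_right _ _) hl)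

/-- Since `min f T ≤ f`, truncation from above costs nothing in the linear term, and the lower tail
needs no truncation because the exponential factor only sees the positive part. -/
theorem integral_exp_mul_min_le {μ : Measure E} [IsProbabilityMeasure μ] {f : E → ℝ}
    (hf : Measurable f) (hfi : Integrable f μ) {p : ℝ} (hp1 : 1 ≤ p) (hp2 : p ≤ 2)
    (hfp : Integrable (fun w => |f w| ^ p) μ) {T l : ℝ} (hT : 0 ≤ T) (hl : 0 ≤ l) :
    ∫ w, Real.exp (l * min (f w) T) ∂μ ≤
      Real.exp (l * ∫ w, f w ∂μ + l ^ p * Real.exp (l * T) * ∫ w, |f w| ^ p ∂μ) := by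
  have key : ∀ w, Real.exp (l * min (f w) T) ≤
      1 + l * f w + (l ^ p * Real.exp (l * T)) * |f w| ^ p := by
    intro w
    refine (exp_le_one_add_add_abs_rpow_mul hp1 hp2 _).trans ?_
    have h1 : l * min (f w) T ≤ l * f w := mul_le_mul_of_nonneg_left (min_le_left _ _) hl
    have h2 : |l * min (f w) T| ^ p ≤ l ^ p * |f w| ^ p := by
      rw [abs_mul, abs_of_nonneg hl, Real.mul_rpow hl (abs_nonneg _)]
      exact mul_le_mul_of_nonneg_left (Real.rpow_le_rpow (abs_nonneg _) (abs_min_le_abs hT)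
        (by linarith)) (by positivity)
    have h3 : Real.exp (max (l * min (f w) T) 0) ≤ Real.exp (l * T) :=
      Real.exp_le_exp.2 (max_le (mul_le_mul_of_nonneg_left (min_le_right _ _) hl) (by positivity))
    have h4 := mul_le_mul h2 h3 (Real.exp_pos _).le (by positivity)
    linarith
  calc ∫ w, Real.exp (l * min (f w) T) ∂μ
      ≤ ∫ w, (1 + l * f w + (l ^ p * Real.exp (l * T)) * |f w| ^ p) ∂μ :=
        integral_mono (integrable_exp_mul_min hf hl)
          (((integrable_const _).add (hfi.const_mul l)).add (hfp.const_mul _)) key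
    _ = (l * ∫ w, f w ∂μ + l ^ p * Real.exp (l * T) * ∫ w, |f w| ^ p ∂μ) + 1 := by
        rw [integral_add (f := fun w => 1 + l * f w)
            ((integrable_const _).add (hfi.const_mul l)) (hfp.const_mul _),
          integral_add (integrable_const _) (hfi.const_mul l), integral_const_mul,
          integral_const_mul]
        simp
        ring
    _ ≤ _ := Real.add_one_le_exp _

/-- Chernoff bound for sums of independent variables truncated at level `T`. -/
theorem measureReal_sum_min_ge_le {μ : Measure E} [IsProbabilityMeasure μ] {f : E → ℝ}
    (hf : Measurable f) (hfi : Integrable f μ) {p : ℝ} (hp1 : 1 ≤ p) (hp2 : p ≤ 2)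
    (hfp : Integrable (fun w => |f w| ^ p) μ) {T l : ℝ} (hT : 0 ≤ T) (hl : 0 ≤ l) (ε : ℝ) (n : ℕ) :
    (Measure.pi fun _ : Fin n => μ).real {y | n * (∫ w, f w ∂μ + ε) ≤ ∑ i, min (f (y i)) T} ≤
      Real.exp (-(n * l * ε) + n * (l ^ p * Real.exp (l * T) * ∫ w, |f w| ^ p ∂μ)) := by
  have hprod : ∀ y : Fin n → E, Real.exp (l * ∑ i, min (f (y i)) T) =
      ∏ i, Real.exp (l * min (f (y i)) T) := fun y => by
    rw [Finset.mul_sum, Real.exp_sum]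
  refine (ProbabilityTheory.measure_ge_le_exp_mul_mgf _ hl ?_).trans ?_
  · simp_rw [hprod]
    exact Integrable.fintype_prod fun _ => integrable_exp_mul_min hf hl
  · unfold ProbabilityTheory.mgf
    simp_rw [hprod]
    rw [integral_fintype_prod_eq_pow (fun w => Real.exp (l * min (f w) T)), Fintype.card_fin]
    have h1 := pow_le_pow_left₀ (integral_nonneg fun w => (Real.exp_pos _).le)
      (integral_exp_mul_min_le hf hfi hp1 hp2 hfp hT hl) n
    refine (mul_le_mul_of_nonneg_left h1 (Real.exp_pos _).le).trans_eq ?_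
    rw [← Real.exp_nat_mul, ← Real.exp_add]
    congr 1
    ring

/-- Union bound and Markov's inequality for the event that some coordinate is large. -/
theorem measureReal_exists_gt_le {μ : Measure E} [IsProbabilityMeasure μ] {f : E → ℝ}
    (hf : Measurable f) {q : ℝ} (hq : 0 < q) (hfq : Integrable (fun w => |f w| ^ q) μ)
    {T : ℝ} (hT : 0 < T) (n : ℕ) :
    (Measure.pi fun _ : Fin n => μ).real {y | ∃ i, T < f (y i)} ≤
      n * ((∫ w, |f w| ^ q ∂μ) / T ^ q) := by
  have hset : {y : Fin n → E | ∃ i, T < f (y i)} = ⋃ i, {y | T < f (y i)} := by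
    ext y; simp
  rw [hset]
  refine (measureReal_iUnion_fintype_le _).trans ?_
  have hone : ∀ i : Fin n, (Measure.pi fun _ : Fin n => μ).real {y | T < f (y i)} ≤
      (∫ w, |f w| ^ q ∂μ) / T ^ q := by
    intro i
    have h1 : (Measure.pi fun _ : Fin n => μ).real {y | T < f (y i)} = μ.real {w | T < f w} := by
      have := (measurePreserving_eval (fun _ : Fin n => μ) i).measureReal_preimage
        (s := {w | T < f w}) (measurableSet_lt measurable_const hf).nullMeasurableSet
      exact this
    rw [h1, le_div_iff₀ (by positivity), mul_comm]
    refine le_trans ?_ (mul_meas_ge_le_integral_of_nonneg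
      (ae_of_all _ fun w => Real.rpow_nonneg (abs_nonneg (f w)) q) hfq (T ^ q))
    refine mul_le_mul_of_nonneg_left (measureReal_mono fun w hw => ?_) (by positivity)
    exact Real.rpow_le_rpow hT.le ((le_of_lt hw).trans (le_abs_self _)) hq.le
  exact (Finset.sum_le_sum fun i _ => hone i).trans_eq (by simp)

theorem tendsto_log_rpow_mul_rpow_neg (p : ℝ) {s : ℝ} (hs : 0 < s) :
    Tendsto (fun n : ℕ => Real.log n ^ p * (n : ℝ) ^ (-s)) atTop (nhds 0) := by
  have h1 := (isLittleO_log_rpow_rpow_atTop p hs).tendsto_div_nhds_zero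
  refine (h1.comp tendsto_natCast_atTop_atTop).congr fun n => ?_
  simp only [Function.comp]
  rw [Real.rpow_neg (Nat.cast_nonneg n), div_eq_mul_inv]

/-- Polynomial upper deviation bound for the empirical mean of a function with a finite absolute
moment of order `q > 1`. -/
theorem exists_eventually_measureReal_sum_ge_le {μ : Measure E} [IsProbabilityMeasure μ]
    {f : E → ℝ} (hf : Measurable f) (hfi : Integrable f μ) {q : ℝ} (hq : 1 < q)
    (hfq : Integrable (fun w => |f w| ^ q) μ) {ε : ℝ} (hε : 0 < ε) :
    ∃ C : ℝ, ∀ᶠ n : ℕ in atTop, (n : ℝ) ^ (q - 1) *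
      (Measure.pi fun _ : Fin n => μ).real
        {y | n * (∫ w, f w ∂μ + ε) ≤ ∑ i, f (y i)} ≤ C := by
  -- The exponential inequality needs `p ≤ 2`, so only part of a higher moment is used here; the
  -- full order `q` enters through the large summands.
  obtain ⟨p, hp1, hp2, hpq⟩ : ∃ p : ℝ, 1 < p ∧ p ≤ 2 ∧ p ≤ q :=
    ⟨min q 2, lt_min hq one_lt_two, min_le_right _ _, min_le_left _ _⟩
  have hfp : Integrable (fun w => |f w| ^ p) μ := by
    refine ((integrable_const (1 : ℝ)).add hfq).mono'
      (hf.abs.pow_const p).aestronglyMeasurable (ae_of_all _ fun w => ?_)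
    rw [Real.norm_of_nonneg (by positivity)]
    change |f w| ^ p ≤ 1 + |f w| ^ q
    have h0 : 0 ≤ |f w| ^ q := by positivity
    rcases le_total |f w| 1 with h1 | h1
    · linarith [Real.rpow_le_one (abs_nonneg (f w)) h1 (by linarith : 0 ≤ p)]
    · linarith [Real.rpow_le_rpow_of_exponent_le h1 hpq]
  set K := ∫ w, |f w| ^ p ∂μ
  set Q := ∫ w, |f w| ^ q ∂μ with hQ
  -- With `l = a log n / n`: `aε = q` gives `exp(-nlε) = n^(-q)`, and `aδ = s` gives `exp(lδn) =
  -- n^s`. The error term is then of order `(log n)^p n^(1-p+s)`, and `s = (p-1)/2` makes its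
  -- exponent `-s`.
  obtain ⟨s, hs, hs2⟩ : ∃ s : ℝ, 0 < s ∧ 1 - p + s = -s := ⟨(p - 1) / 2, by linarith, by ring⟩
  obtain ⟨a, ha, haε⟩ : ∃ a : ℝ, 0 < a ∧ a * ε = q := ⟨q / ε, by positivity, by field_simp⟩
  obtain ⟨δ, hδ, hδs⟩ : ∃ δ : ℝ, 0 < δ ∧ a * δ = s := ⟨s / a, by positivity, by field_simp⟩
  refine ⟨Q / δ ^ q + Real.exp 1, ?_⟩
  have hlim : Tendsto (fun n : ℕ => a ^ p * K * (Real.log n ^ p * (n : ℝ) ^ (-s))) atTop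
      (nhds 0) := by
    simpa using (tendsto_log_rpow_mul_rpow_neg p hs).const_mul (a ^ p * K)
  filter_upwards [eventually_ge_atTop 1, hlim.eventually (gt_mem_nhds one_pos)] with n hn hsmall
  have hn1 : (1 : ℝ) ≤ n := by exact_mod_cast hn
  have hn0 : (0 : ℝ) < n := by linarith
  have hlog : 0 ≤ Real.log n := Real.log_nonneg hn1
  have hT : 0 < δ * n := by positivity
  set l : ℝ := a * Real.log n / n with hl
  have hl0 : 0 ≤ l := by positivity
  have hsub : {y : Fin n → E | n * (∫ w, f w ∂μ + ε) ≤ ∑ i, f (y i)} ⊆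
      {y | ∃ i, δ * n < f (y i)} ∪
        {y | n * (∫ w, f w ∂μ + ε) ≤ ∑ i, min (f (y i)) (δ * n)} := by
    intro y hy
    by_cases hex : ∃ i, δ * n < f (y i)
    · exact Or.inl hex
    · right
      push Not at hex
      simp only [mem_ofPred_eq] at hy ⊢
      rwa [Finset.sum_congr rfl fun i _ => min_eq_left (hex i)]
  have hA := measureReal_exists_gt_le hf (by linarith) hfq hT n
  have hB := measureReal_sum_min_ge_le hf hfi hp1.le hp2 hfp hT.le hl0 ε n
  have hB' : -(n * l * ε) + n * (l ^ p * Real.exp (l * (δ * n)) * K) ≤ Real.log n * (-q) + 1 := by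
    have e1 : n * l * ε = Real.log n * q := by
      rw [hl, ← haε]; field_simp
    have e2 : l * (δ * n) = Real.log n * s := by
      rw [hl, ← hδs]; field_simp
    have e3 : n * (l ^ p * Real.exp (l * (δ * n)) * K) =
        a ^ p * K * (Real.log n ^ p * (n : ℝ) ^ (-s)) := by
      rw [e2, ← Real.rpow_def_of_pos hn0, hl, Real.div_rpow (by positivity) hn0.le,
        Real.mul_rpow ha.le hlog, ← hs2, Real.rpow_add hn0, Real.rpow_sub hn0, Real.rpow_one]
      ring
    rw [e1, e3]
    linarith
  have hB2 := hB.trans (Real.exp_le_exp.2 hB')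
  rw [Real.exp_add, ← Real.rpow_def_of_pos hn0] at hB2
  have hU := (measureReal_mono hsub (by finiteness)).trans
    ((measureReal_union_le _ _).trans (add_le_add hA hB2))
  refine (mul_le_mul_of_nonneg_left hU (by positivity)).trans ?_
  rw [mul_add]
  refine add_le_add (le_of_eq ?_) ?_
  · rw [Real.mul_rpow hδ.le hn0.le, Real.rpow_sub hn0, Real.rpow_one]
    field_simp
    exact hQ.symm
  · rw [← mul_assoc, ← Real.rpow_add hn0]
    refine mul_le_of_le_one_left (Real.exp_pos _).le ?_
    exact Real.rpow_le_one_of_one_le_of_nonpos hn1 (by linarith)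

/-! ### The envelope and infima over small balls -/

theorem le_envelope {X E : Type*} [TopologicalSpace X] [CompactSpace X] {h : X → E → ℝ} {w : E}
    (hc : Continuous fun x => h x w) (x : X) : h x w ≤ envelope h w :=
  (le_ciSup (isCompact_range hc).bddAbove x).trans (le_max_left _ _)

theorem measurable_envelope {X E : Type*} [MetricSpace X] [CompactSpace X]
    [TopologicalSpace E] [MeasurableSpace E] [BorelSpace E] {h : X → E → ℝ}
    (hc : Continuous (Function.uncurry h)) : Measurable (envelope h) := by
  have h1 : LowerSemicontinuous fun w => ⨆ x, h x w :=
    lowerSemicontinuous_ciSup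
      (fun w => (isCompact_range (hc.comp (Continuous.prodMk_left w))).bddAbove)
      fun x => (hc.comp (Continuous.prodMk_right x)).lowerSemicontinuous
  exact h1.measurable.max measurable_const

theorem memLp_const_add {E : Type*} [MeasurableSpace E] {μ : Measure E}
    [IsProbabilityMeasure μ] {ψ : E → ℝ} (hψ : Measurable ψ) (hψ0 : ∀ w, 0 ≤ ψ w) {q : ℝ}
    (hq : 1 ≤ q) (hμ : ∫⁻ w, ENNReal.ofReal (ψ w) ^ q ∂μ < ∞) (c : ℝ) :
    MemLp (fun w => c + ψ w) (ENNReal.ofReal q) μ := by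
  refine (memLp_const c).add ⟨hψ.aestronglyMeasurable, ?_⟩
  have hq0 : 0 < q := by linarith
  rw [eLpNorm_lt_top_iff_lintegral_rpow_enorm_lt_top (by simpa using hq0) ENNReal.ofReal_ne_top,
    ENNReal.toReal_ofReal hq0.le]
  refine (lintegral_congr fun w => ?_).trans_lt hμ
  rw [Real.enorm_of_nonneg (hψ0 w)]

variable {X E : Type*} [MetricSpace X]

/-- The infimum of `h · w` over the ball of radius `r` around `x`. -/
noncomputable def ballInf (h : X → E → ℝ) (x : X) (r : ℝ) (w : E) : ℝ :=
  ⨅ z : Metric.ball x r, h z w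

theorem ballInf_le {h : X → E → ℝ} {c : ℝ} (hb : ∀ x w, -c ≤ h x w) {x z : X} {r : ℝ}
    (hz : z ∈ Metric.ball x r) (w : E) : ballInf h x r w ≤ h z w :=
  ciInf_le (f := fun z : Metric.ball x r => h z w)
    ⟨-c, by rintro _ ⟨z, rfl⟩; exact hb _ _⟩ ⟨z, hz⟩

theorem le_ballInf {h : X → E → ℝ} {x : X} {r : ℝ} (hr : 0 < r) {w : E} {c : ℝ}
    (hb : ∀ z ∈ Metric.ball x r, c ≤ h z w) : c ≤ ballInf h x r w :=
  haveI : Nonempty (Metric.ball x r) := ⟨⟨x, Metric.mem_ball_self hr⟩⟩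
  le_ciInf fun z => hb z z.2

theorem measurable_ballInf [TopologicalSpace E] [MeasurableSpace E] [BorelSpace E]
    {h : X → E → ℝ} (hc : Continuous (Function.uncurry h)) {c : ℝ} (hb : ∀ x w, -c ≤ h x w)
    (x : X) (r : ℝ) : Measurable (ballInf h x r) :=
  (upperSemicontinuous_ciInf (f := fun (z : Metric.ball x r) w => h z w)
    (fun w => ⟨-c, by rintro _ ⟨z, rfl⟩; exact hb _ _⟩)
    fun z => (hc.comp (Continuous.prodMk_right z.1)).upperSemicontinuous).measurable

theorem tendsto_ballInf {h : X → E → ℝ} {c : ℝ} (hb : ∀ x w, -c ≤ h x w) {w : E}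
    (hc : Continuous fun x => h x w) (x : X) :
    Tendsto (fun k : ℕ => ballInf h x (1 / ((k : ℝ) + 1)) w) atTop (nhds (h x w)) := by
  have hpos : ∀ k : ℕ, (0 : ℝ) < 1 / ((k : ℝ) + 1) := fun k => by positivity
  rw [Metric.tendsto_atTop]
  intro η hη
  obtain ⟨ρ, hρ, hball⟩ := Metric.continuous_iff.1 hc x (η / 2) (by linarith)
  obtain ⟨N, hN⟩ := exists_nat_one_div_lt hρ
  refine ⟨N, fun k hk => ?_⟩
  have h1 : ballInf h x (1 / ((k : ℝ) + 1)) w ≤ h x w :=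
    ballInf_le hb (Metric.mem_ball_self (hpos k)) w
  have h2 : h x w - η / 2 ≤ ballInf h x (1 / ((k : ℝ) + 1)) w := by
    refine le_ballInf (hpos k) fun z hz => ?_
    have h3 : (1 : ℝ) / ((k : ℝ) + 1) ≤ 1 / ((N : ℝ) + 1) := by
      have : (N : ℝ) ≤ k := by exact_mod_cast hk
      gcongr
    have h4 := hball z (lt_of_lt_of_le (Metric.mem_ball.1 hz) (h3.trans hN.le))
    rw [Real.dist_eq, abs_lt] at h4
    linarith
  rw [Real.dist_eq, abs_lt]
  constructor <;> linarith

theorem abs_ballInf_le {h : X → E → ℝ} {c : ℝ} (hc : 0 ≤ c) (hb : ∀ x w, -c ≤ h x w) {ψ : E → ℝ}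
    (hψ0 : ∀ w, 0 ≤ ψ w) (hψ : ∀ x w, h x w ≤ ψ w) (x : X) {r : ℝ} (hr : 0 < r) (w : E) :
    |ballInf h x r w| ≤ c + ψ w := by
  have h1 := ballInf_le hb (Metric.mem_ball_self (x := x) hr) w
  have h2 : -c ≤ ballInf h x r w := le_ballInf hr fun z _ => hb z w
  rw [abs_le]
  constructor <;> linarith [hψ x w, hψ0 w]

/-- Dominated convergence with bound `c + ψ`, used both for the infima as the radius shrinks and for
continuity of the cost. The last clause later moves the excess of a point of the ball to its centre.
-/
theorem exists_ball_approx [TopologicalSpace E] [MeasurableSpace E] [BorelSpace E]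
    {μ : Measure E} {h : X → E → ℝ} (hcont : Continuous (Function.uncurry h)) {c : ℝ} (hc : 0 ≤ c)
    (hb : ∀ x w, -c ≤ h x w) {ψ : E → ℝ} (hψ0 : ∀ w, 0 ≤ ψ w) (hψ : ∀ x w, h x w ≤ ψ w)
    (hint : Integrable (fun w => c + ψ w) μ) {η : ℝ} (hη : 0 < η) (x : X) :
    ∃ r : ℝ, 0 < r ∧ ∫ w, h x w ∂μ - η < ∫ w, ballInf h x r w ∂μ ∧
      ∀ z ∈ Metric.ball x r, ∫ w, h z w ∂μ < ∫ w, h x w ∂μ + η := by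
  have hF : Continuous fun x => ∫ w, h x w ∂μ := by
    refine continuous_of_dominated (bound := fun w => c + ψ w)
      (fun x => (hcont.comp (Continuous.prodMk_right x)).measurable.aestronglyMeasurable)
      (fun x => ae_of_all _ fun w => ?_) hint
      (ae_of_all _ fun w => hcont.comp (Continuous.prodMk_left w))
    rw [Real.norm_eq_abs, abs_le]
    constructor <;> linarith [hb x w, hψ x w, hψ0 w]
  have hG : Tendsto (fun k : ℕ => ∫ w, ballInf h x (1 / ((k : ℝ) + 1)) w ∂μ) atTop
      (nhds (∫ w, h x w ∂μ)) :=
    tendsto_integral_of_dominated_convergence (fun w => c + ψ w)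
      (fun k => (measurable_ballInf hcont hb x _).aestronglyMeasurable) hint
      (fun k => ae_of_all _ fun w => abs_ballInf_le hc hb hψ0 hψ x (by positivity) w)
      (ae_of_all _ fun w => tendsto_ballInf hb (hcont.comp (Continuous.prodMk_left w)) x)
  obtain ⟨ρ, hρ, hball⟩ := Metric.continuous_iff.1 hF x η hη
  have hR : ∀ᶠ k : ℕ in atTop, 1 / ((k : ℝ) + 1) < ρ :=
    tendsto_one_div_add_atTop_nhds_zero_nat.eventually (gt_mem_nhds hρ)
  obtain ⟨k, hk1, hk2⟩ := (hR.and (hG.eventually (lt_mem_nhds (sub_lt_self _ hη)))).exists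
  refine ⟨1 / ((k : ℝ) + 1), by positivity, hk2, fun z hz => ?_⟩
  have h4 := hball z ((Metric.mem_ball.1 hz).trans hk1)
  rw [Real.dist_eq, abs_lt] at h4
  linarith

/-! ### Excess cost of empirical minimizers -/

theorem integral_empiricalMeasure {E : Type*} [MeasurableSpace E] [MeasurableSingletonClass E]
    {n : ℕ} (y : Fin n → E) (f : E → ℝ) :
    ∫ w, f w ∂(empiricalMeasure y) = (n : ℝ)⁻¹ * ∑ i, f (y i) := by
  rw [empiricalMeasure, integral_smul_measure, integral_finsetSum_measure
    (fun i _ => integrable_dirac (by simp))]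
  simp

/-- With probability `1 - O(n^(1 - q))`, the true cost of every minimizer of the empirical cost is
within `ε` of that of any fixed `x₀`. -/
theorem exists_eventually_measureReal_excess_ge_le [CompactSpace X]
    [TopologicalSpace E] [MeasurableSpace E] [BorelSpace E]
    {μ : Measure E} [IsProbabilityMeasure μ] {h : X → E → ℝ}
    (hcont : Continuous (Function.uncurry h)) {c : ℝ} (hc : 0 ≤ c)
    (hb : ∀ x w, -c ≤ h x w) {q : ℝ} (hq : 1 < q)
    (hμ : ∫⁻ w, ENNReal.ofReal (envelope h w) ^ q ∂μ < ∞) (x₀ : X) {ε : ℝ} (hε : 0 < ε) :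
    ∃ C : ℝ, ∀ᶠ n : ℕ in atTop, (n : ℝ) ^ (q - 1) *
      (Measure.pi fun _ : Fin n => μ).real
        {y | ∃ x, ∑ i, h x (y i) ≤ ∑ i, h x₀ (y i) ∧
          ε ≤ ∫ w, h x w ∂μ - ∫ w, h x₀ w ∂μ} ≤ C := by
  set ψ := envelope h
  have hψ0 : ∀ w, 0 ≤ ψ w := fun w => le_max_right _ _
  have hψ : ∀ x w, h x w ≤ ψ w := fun x w =>
    le_envelope (h := h) (hcont.comp (Continuous.prodMk_left w)) x
  have hLp : MemLp (fun w => c + ψ w) (ENNReal.ofReal q) μ :=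
    memLp_const_add (measurable_envelope hcont) hψ0 hq.le hμ c
  have hq1 : (1 : ℝ≥0∞) ≤ ENNReal.ofReal q := by simpa using hq.le
  have hint := hLp.integrable hq1
  have hdev : ∀ f : E → ℝ, Measurable f → (∀ w, |f w| ≤ c + ψ w) → ∃ C : ℝ, ∀ᶠ n : ℕ in atTop,
      (n : ℝ) ^ (q - 1) * (Measure.pi fun _ : Fin n => μ).real
        {y | n * (∫ w, f w ∂μ + ε / 4) ≤ ∑ i, f (y i)} ≤ C := by
    intro f hf hfb
    have hfLp : MemLp f (ENNReal.ofReal q) μ :=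
      hLp.mono hf.aestronglyMeasurable (ae_of_all _ fun w => by
        simpa using (hfb w).trans (le_abs_self _))
    refine exists_eventually_measureReal_sum_ge_le hf (hfLp.integrable hq1) hq ?_ (by linarith)
    have := hfLp.integrable_norm_rpow (by simpa using by linarith) ENNReal.ofReal_ne_top
    simpa [ENNReal.toReal_ofReal (by linarith : 0 ≤ q)] using this
  choose r hr hrG hrF using fun x =>
    exists_ball_approx hcont hc hb hψ0 hψ hint (by linarith : 0 < ε / 8) x
  obtain ⟨t, ht⟩ := isCompact_univ.elim_finite_subcover (fun x => Metric.ball x (r x))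
    (fun x => Metric.isOpen_ball) fun x _ => mem_iUnion.2 ⟨x, Metric.mem_ball_self (hr x)⟩
  obtain ⟨C₀, hC₀⟩ := hdev (h x₀) (hcont.comp (Continuous.prodMk_right x₀)).measurable fun w => by
    rw [abs_le]
    constructor <;> linarith [hb x₀ w, hψ x₀ w, hψ0 w]
  -- The negative sign turns the upper deviation bound into a lower one.
  choose C hC using fun x => hdev (fun w => -ballInf h x (r x) w)
    (measurable_ballInf hcont hb x _).neg fun w => by
      rw [abs_neg]; exact abs_ballInf_le hc hb hψ0 hψ x (hr x) w
  refine ⟨C₀ + ∑ x ∈ t, C x, ?_⟩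
  filter_upwards [eventually_ge_atTop 1, hC₀, (eventually_all_finset t).2 fun x _ => hC x]
    with n hn hn₀ hnt
  have hn0 : (0 : ℝ) < n := by exact_mod_cast hn
  set A₀ := {y : Fin n → E | n * (∫ w, h x₀ w ∂μ + ε / 4) ≤ ∑ i, h x₀ (y i)} with hA₀
  set A := fun x => {y : Fin n → E | n * (∫ w, -ballInf h x (r x) w ∂μ + ε / 4) ≤
    ∑ i, -ballInf h x (r x) (y i)} with hA
  have hsub : {y : Fin n → E | ∃ x, ∑ i, h x (y i) ≤ ∑ i, h x₀ (y i) ∧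
      ε ≤ ∫ w, h x w ∂μ - ∫ w, h x₀ w ∂μ} ⊆ A₀ ∪ ⋃ x ∈ t, A x := by
    rintro y ⟨x, hx, hxε⟩
    by_contra hcon
    simp only [hA₀, hA, mem_union, mem_iUnion, mem_ofPred_eq, not_or, not_exists, not_le,
      integral_neg, Finset.sum_neg_distrib] at hcon
    obtain ⟨hy₀, hyt⟩ := hcon
    obtain ⟨z, hzt, hxz⟩ : ∃ z ∈ t, x ∈ Metric.ball z (r z) := by
      simpa using ht (mem_univ x)
    have h1 := hyt z hzt
    have h2 : ∑ i, ballInf h z (r z) (y i) ≤ ∑ i, h x (y i) :=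
      Finset.sum_le_sum fun i _ => ballInf_le hb hxz _
    -- Two deviations of `ε/4` and two approximation errors of `ε/8` bound the excess at `x` by
    -- `3ε/4 < ε`.
    have h3 : (n : ℝ) * (∫ w, ballInf h z (r z) w ∂μ) <
        n * (∫ w, h x₀ w ∂μ + ε / 4 + ε / 4) := by linarith
    have h4 := lt_of_mul_lt_mul_left h3 hn0.le
    linarith [hrG z, hrF z x hxz]
  have hle := (measureReal_mono (μ := Measure.pi fun _ : Fin n => μ) hsub (by finiteness)).trans
    ((measureReal_union_le _ _).trans (add_le_add_right (measureReal_biUnion_finset_le t A) _))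
  refine (mul_le_mul_of_nonneg_left hle (by positivity)).trans ?_
  rw [mul_add, Finset.mul_sum]
  exact add_le_add hn₀ (Finset.sum_le_sum fun x hx => hnt x hx)

theorem limsup_rpow_mul_lt_top {q : ℝ} (hq : 1 < q) {E : Type*} [MeasurableSpace E]
    {μ : Measure E} [IsProbabilityMeasure μ] {A : ∀ n : ℕ, Set (Fin n → E)} {C : ℝ}
    (hA : ∀ᶠ n : ℕ in atTop,
      (n : ℝ) ^ (q - 1) * (Measure.pi fun _ : Fin n => μ).real (A n) ≤ C) :
    limsup (fun n : ℕ+ => ((n : ℕ) : ℝ≥0∞) ^ (q - 1) *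
      Measure.pi (fun _ : Fin (n : ℕ) => μ) (A n)) atTop < ∞ := by
  refine (limsup_le_of_le (a := ENNReal.ofReal C) (by isBoundedDefault) ?_).trans_lt
    ENNReal.ofReal_lt_top
  filter_upwards [tendsto_PNat_val_atTop_atTop.eventually hA] with n hn
  refine le_trans (le_of_eq ?_) (ENNReal.ofReal_le_ofReal hn)
  rw [ENNReal.ofReal_mul (by positivity), ofReal_measureReal (by finiteness),
    ← ENNReal.ofReal_rpow_of_nonneg (by positivity) (by linarith), ENNReal.ofReal_natCast]

end HeavyTailedOptimization

theorem theorem4p7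
    {X E : Type*}
    [MetricSpace X] [CompactSpace X] [MeasurableSpace X] [BorelSpace X]
    [TopologicalSpace E] [PolishSpace E] [MeasurableSpace E] [BorelSpace E]
    (h : X → E → ℝ)
    (h_cont : Continuous (Function.uncurry h))
    (h_bdd : BddBelow (range (Function.uncurry h)))
    (q : ℝ) (hq : 1 < q)
    (μ : ProbabilityMeasure E)
    (hμ : ∫⁻ w, ENNReal.ofReal (HeavyTailedOptimization.envelope h w) ^ q ∂(μ : Measure E) < ∞)
    (xhat : HeavyTailedOptimization.ProbWith (HeavyTailedOptimization.envelope h) → X)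
    (xhat_meas : Measurable xhat)
    (xhat_min : ∀ ν, IsMinOn (fun x => ∫ w, h x w ∂ν.toMeasure) univ (xhat ν))
    (φ : ℝ → ℝ) (φ_meas : Measurable φ)
    (growth : ∀ x : X,
      φ (dist (xhat (.ofMoment hq.le μ hμ)) x) ≤
        (∫ w, h x w ∂(μ : Measure E)) -
          ∫ w, h (xhat (.ofMoment hq.le μ hμ)) w ∂(μ : Measure E)) :
    (∀ ε : ℝ, 0 < ε →
      limsup (fun n : ℕ+ => ((n : ℕ) : ℝ≥0∞) ^ (q - 1) *
        Measure.pi (fun _ : Fin (n : ℕ) => (μ : Measure E))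
          {y | ε ≤ φ (dist (xhat (.ofMoment hq.le μ hμ))
            (xhat (HeavyTailedOptimization.empirical _ y)))}) atTop < ∞) ∧
    (StrictMono φ → φ 0 = 0 → ∀ ε : ℝ, 0 < ε →
      limsup (fun n : ℕ+ => ((n : ℕ) : ℝ≥0∞) ^ (q - 1) *
        Measure.pi (fun _ : Fin (n : ℕ) => (μ : Measure E))
          {y | ε ≤ dist (xhat (.ofMoment hq.le μ hμ))
            (xhat (HeavyTailedOptimization.empirical _ y))}) atTop < ∞) := by
  set x₀ := xhat (.ofMoment hq.le μ hμ) with hx₀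
  obtain ⟨b, hb⟩ := h_bdd
  have hb' : ∀ x w, -|b| ≤ h x w := fun x w =>
    (neg_abs_le b).trans (hb (mem_range_self (f := Function.uncurry h) (x, w)))
  have main : ∀ ε : ℝ, 0 < ε →
      limsup (fun n : ℕ+ => ((n : ℕ) : ℝ≥0∞) ^ (q - 1) *
        Measure.pi (fun _ : Fin (n : ℕ) => (μ : Measure E))
          {y | ε ≤ φ (dist x₀ (xhat (HeavyTailedOptimization.empirical _ y)))}) atTop < ∞ := by
    intro ε hε
    obtain ⟨C, hC⟩ := HeavyTailedOptimization.exists_eventually_measureReal_excess_ge_le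
      h_cont (abs_nonneg b) hb' hq hμ x₀ hε
    refine (limsup_le_limsup (Eventually.of_forall fun n : ℕ+ => ?_)).trans_lt
      (HeavyTailedOptimization.limsup_rpow_mul_lt_top hq hC)
    refine mul_le_mul_right (measure_mono fun y hy => ?_) _
    have hn : (0 : ℝ) < ((n : ℕ) : ℝ) := by exact_mod_cast n.pos
    refine ⟨xhat (HeavyTailedOptimization.empirical _ y), ?_, le_trans hy (growth _)⟩
    have hmin := xhat_min (HeavyTailedOptimization.empirical _ y) (mem_univ x₀)
    simp only [mem_ofPred_eq] at hmin
    change ∫ w, h _ w ∂(HeavyTailedOptimization.empiricalMeasure y) ≤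
      ∫ w, h _ w ∂(HeavyTailedOptimization.empiricalMeasure y) at hmin
    rw [HeavyTailedOptimization.integral_empiricalMeasure,
      HeavyTailedOptimization.integral_empiricalMeasure] at hmin
    exact le_of_mul_le_mul_left hmin (by positivity)
  refine ⟨main, fun hmono hφ0 ε hε => ?_⟩
  -- Monotonicity puts `d ≥ ε` inside `φ(d) ≥ φ(ε)`, so `φ(ε)` serves as the new threshold.
  have hφε : 0 < φ ε := hφ0 ▸ hmono hε
  refine (limsup_le_limsup (Eventually.of_forall fun n : ℕ+ => ?_)).trans_lt (main (φ ε) hφε)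
  exact mul_le_mul_right (measure_mono fun y hy => hmono.monotone hy) _
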